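/- Theorem (Linear convergence of gradient flow on $[0,T]$). Let $N,P,M,n\in\mathbb N$ with $P\ge nM$. Let $$f(X,\theta)=g_L\bigl(\sigma(\cdots g_2(\sigma(g_1(X,\theta)),\theta)\cdots),\theta\bigr),\qquad X\in\mathbb R^N,\ \theta\in\mathbb R^P,$$ where $L\ge 1$, $N_0=N$, $N_L=M$, each $g_i:\mathbb R^{N_{i-1}}\times\mathbb R^P\to\mathbb R^{N_i}$ is polynomial in every component, and $\sigma:\mathbb R\to\mathbb R$, applied componentwise, is continuous, piecewise polynomial (with finitely many closed intervals as pieces), and zero at only finitely many points. Assume that $f$ depends effectively on its parameters: for no nonempty open sets $U\subset\mathbb R^N$, $V\subset\mathbb R^P$ is $f(X,\theta)$ independent of $\theta\in V$ for every $X\in U$. Let $y_1,\dots,y_n\in\mathbb R^M$ be given targets, and let the initialization $\theta_0\in\mathbb R^P$ and the inputs $X_1,\dots,X_n\in\mathbb R^N$ be random with a joint law that is absolutely continuous with respect to Lebesgue measure (for instance, independent with absolutely continuous laws). Let $\mathcal L(\theta)=\frac12\sum_{j=1}^n\|f(X_j,\theta)-y_j\|^2$. A gradient flow curve on $[0,T]$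 from $\theta_0$ is a continuous $\theta:[0,T]\to\mathbb R^P$ with $\theta(0)=\theta_0$ such that, for all but finitely many $t\in(0,T)$, $\mathcal L$ is differentiable at $\theta(t)$, $\theta$ is differentiable at $t$, and $\theta'(t)=-\nabla\mathcal L(\theta(t))$. Write $y\in\mathbb R^{nM}$ and $F_t\in\mathbb R^{nM}$ for the concatenations of $y_1,\dots,y_n$ and of $f(X_1,\theta(t)),\dots,f(X_n,\theta(t))$. Then, almost surely with respect to $(\theta_0,X_1,\dots,X_n)$, for every $T>0$ there is $\lambda_0>0$ such that every gradient flow curve on $[0,T]$ from $\theta_0$ satisfies, for all $t\in[0,T]$, $$\|y-F_t\|\le e^{-\lambda_0t}\|y-F_0\|,$$ and equivalently $\mathcal L(\theta(t))\le e^{-2\lambda_0t}\mathcal L(\theta(0))$. -/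

import Mathlib

open MeasureTheory

/-- A continuous function is piecewise polynomial if the real line is covered by finitely many
closed intervals (possibly unbounded or degenerate), on each of which the function agrees with a
polynomial. -/
def IsPiecewisePolynomial (σ : ℝ → ℝ) : Prop :=
  ∃ (m : ℕ) (S : Fin m → Set ℝ) (p : Fin m → Polynomial ℝ),
    (∀ i, IsClosed (S i) ∧ (S i).OrdConnected) ∧ (⋃ i, S i) = Set.univ ∧
      ∀ i, ∀ x ∈ S i, σ x = (p i).eval x

/-- A finite, nonempty sequence of polynomial layers `g₁, …, g_L` with `P` shared parameters, input
dimension `N` and output dimension `M`. A layer `ℝ^K × ℝ^P → ℝ^K'` is given by one polynomial for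
each output component; `Sum.inl` labels the input variables, `Sum.inr` the parameters. -/
inductive PolyLayers (P : ℕ) : ℕ → ℕ → Type
  | last {N M : ℕ} (g : Fin M → MvPolynomial (Fin N ⊕ Fin P) ℝ) : PolyLayers P N M
  | cons {N K M : ℕ} (g : Fin K → MvPolynomial (Fin N ⊕ Fin P) ℝ) (rest : PolyLayers P K M) :
      PolyLayers P N M

namespace PolyLayers

/-- `g_L (σ (⋯ σ (g₁ (x, θ)) ⋯, θ), θ)`, with `σ` applied componentwise. -/
noncomputable def eval {P : ℕ} (σ : ℝ → ℝ) (θ : Fin P → ℝ) :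
    {N M : ℕ} → PolyLayers P N M → (Fin N → ℝ) → Fin M → ℝ
  | _, _, last g, x => fun k => MvPolynomial.eval (Sum.elim x θ) (g k)
  | _, _, cons g rest, x =>
      eval σ θ rest (fun k => σ (MvPolynomial.eval (Sum.elim x θ) (g k)))

/-- The network function `f(X, θ)` between Euclidean spaces. -/
noncomputable def f {P N M : ℕ} (net : PolyLayers P N M) (σ : ℝ → ℝ)
    (X : EuclideanSpace ℝ (Fin N)) (θ : EuclideanSpace ℝ (Fin P)) : EuclideanSpace ℝ (Fin M) :=
  WithLp.toLp 2 (net.eval σ θ X)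

/-- The network output depends effectively on its parameters: there are no nonempty open sets of
inputs and of parameters on whose product the output does not depend on the parameters. -/
def DependsOnParameters {P N M : ℕ} (net : PolyLayers P N M) (σ : ℝ → ℝ) : Prop :=
  ∀ (U : Set (EuclideanSpace ℝ (Fin N))) (V : Set (EuclideanSpace ℝ (Fin P))),
    IsOpen U → U.Nonempty → IsOpen V → V.Nonempty →
      ∃ X ∈ U, ∃ θ ∈ V, ∃ θ' ∈ V, net.f σ X θ ≠ net.f σ X θ'

/-- The squared loss `½ ∑ⱼ ‖f(Xⱼ, θ) - yⱼ‖²`. -/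
noncomputable def loss {P N M n : ℕ} (net : PolyLayers P N M) (σ : ℝ → ℝ)
    (X : Fin n → EuclideanSpace ℝ (Fin N)) (y : Fin n → EuclideanSpace ℝ (Fin M))
    (θ : EuclideanSpace ℝ (Fin P)) : ℝ :=
  (1 / 2 : ℝ) * ∑ j, ‖net.f σ (X j) θ - y j‖ ^ 2

end PolyLayers

/-- Concatenation of `n` vectors of `ℝ^M` into one vector of `ℝ^(nM)`. -/
noncomputable def stack {n M : ℕ} (v : Fin n → EuclideanSpace ℝ (Fin M)) :
    EuclideanSpace ℝ (Fin n × Fin M) :=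
  WithLp.toLp 2 (fun q => v q.1 q.2)

/-- `θ` is a gradient flow curve of `Loss` on `[0, T]` started at `θ₀`: it is continuous, and at
all but finitely many times `Loss` is differentiable at `θ t`, the curve is differentiable at `t`,
and `θ' = -∇ Loss(θ)`. -/
structure IsGradientFlow {P : ℕ} (Loss : EuclideanSpace ℝ (Fin P) → ℝ)
    (θ₀ : EuclideanSpace ℝ (Fin P)) (T : ℝ) (θ : ℝ → EuclideanSpace ℝ (Fin P)) : Prop where
  init : θ 0 = θ₀
  continuousOn : ContinuousOn θ (Set.Icc 0 T)
  flow : ∃ S : Set ℝ, S.Finite ∧ ∀ t ∈ Set.Ioo 0 T \ S,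
    ∃ v : EuclideanSpace ℝ (Fin P), HasGradientAt Loss v (θ t) ∧ HasDerivAt θ (-v) t

/-!
Since `T` is fixed before the rate, exponential decay on `[0, T]` only requires that the loss drops
by a definite amount within a short time and never increases afterwards. So everything reduces to
one fact: almost surely the loss is continuously differentiable near `θ₀` with nonzero gradient
there.

For the analytic part (`exists_exp_decay_of_fderiv_ne_zero`), the energy identity
`(Loss ∘ θ)' = -‖∇ Loss‖²` bounds the distance travelled up to time `t` by `a t + Loss θ₀ / (4a)`
for every `a > 0`. This keeps all gradient flow curves, for a common positive time, in a ball on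
which the gradient is bounded below. There the loss decreases at least linearly; afterwards it does
not increase, because it is continuous and the flow equation fails at finitely many times only. A
linear bound `Loss θ₀ - c t` on `[0, T]` lies below an exponential one.

For the probabilistic part, zero sets of nonzero polynomials are null sets, so a preactivation that
is locally a nonconstant polynomial almost never meets a breakpoint of `σ`, while a locally constant
one stays locally constant after applying `σ`. By induction on the layers, near almost every point
all network outputs are polynomials `q` in the parameters and inputs
(`IsAELocallyPolynomial.polyLayers_eval`), and the loss is a polynomial `½ ∑ (q - y)²`. If its
derivatives in all parameters vanished identically, each `q` would, for fixed inputs, be a bounded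
polynomial in the parameters, hence constant
(`MvPolynomial.eval_eq_of_pderiv_sum_sq_eq_zero`), which contradicts the effective dependence on the
parameters. So some partial derivative is a nonzero polynomial, and it is nonzero almost everywhere
(`PolyLayers.ae_contDiffAt_loss_and_fderiv_ne_zero`).
-/

/-! ### Polynomials in several real variables -/

/-- The derivative of a polynomial function in terms of the formal partial derivatives. -/
theorem MvPolynomial.hasFDerivAt_eval {ι : Type*} [Fintype ι] (p : MvPolynomial ι ℝ) (x : ι → ℝ) :
    HasFDerivAt (fun z : ι → ℝ => eval z p)
      (∑ i, eval x (pderiv i p) • ContinuousLinearMap.proj (R := ℝ) (φ := fun _ : ι => ℝ) i) x := by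
  classical
  induction p using MvPolynomial.induction_on with
  | C a => simpa using hasFDerivAt_const a x
  | add p q hp hq =>
    simpa [add_smul, Finset.sum_add_distrib] using hp.fun_add hq
  | mul_X p j hp =>
    have h := hp.mul (ContinuousLinearMap.proj (R := ℝ) (φ := fun _ : ι => ℝ) j).hasFDerivAt
    simp only [map_mul, eval_X]
    refine h.congr_fderiv ?_
    ext v
    simp [pderiv_X, Pi.single_apply, Finset.sum_add_distrib, mul_add, Finset.mul_sum,
      mul_comm, mul_left_comm, apply_ite]

/-- A polynomial function that is bounded on a line is constant on it. -/
theorem MvPolynomial.eval_add_eq_of_bounded {ι : Type*} (p : MvPolynomial ι ℝ) (x d : ι → ℝ)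
    {c : ℝ} (h : ∀ t : ℝ, |eval (x + t • d) p| ≤ c) : eval (x + d) p = eval x p := by
  set u : Polynomial ℝ :=
    aeval (fun i => Polynomial.C (x i) + Polynomial.C (d i) * Polynomial.X) p with hu
  have hev (t : ℝ) : u.eval t = eval (x + t • d) p := by
    rw [hu, ← Polynomial.coe_evalRingHom, MvPolynomial.map_aeval, MvPolynomial.eval]
    congr 2
    · ext; simp
    · ext; simpa using mul_comm _ _
  have hdeg : u.degree ≤ 0 := by
    rw [← Polynomial.isBoundedUnder_abs_atTop_iff]
    exact Filter.isBoundedUnder_of ⟨c, fun t => by simpa [hev] using h t⟩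
  have h0 := hev 0
  have h1 := hev 1
  rw [Polynomial.eq_C_of_degree_le_zero hdeg, Polynomial.eval_C] at h0 h1
  simpa using h1.symm.trans h0

/-- By Fubini: for almost every value of the other variables, the polynomial is nonzero in the first
variable, hence has finitely many roots. -/
theorem MvPolynomial.volume_eval_eq_zero_fin {m : ℕ} {p : MvPolynomial (Fin m) ℝ} (hp : p ≠ 0) :
    volume {x : Fin m → ℝ | eval x p = 0} = 0 := by
  induction m with
  | zero =>
    have : {x : Fin 0 → ℝ | eval x p = 0} = ∅ := by
      rw [Set.eq_empty_iff_forall_notMem]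
      intro x hx
      rw [Set.mem_ofPred_eq, eq_C_of_isEmpty p, eval_C] at hx
      exact hp (by rw [eq_C_of_isEmpty p, hx, C_0])
    simp [this]
  | succ m ih =>
    set S : Set (ℝ × (Fin m → ℝ)) := {z | eval (Fin.cons z.1 z.2 : Fin (m + 1) → ℝ) p = 0} with hS
    have hSm : MeasurableSet S := by
      refine (isClosed_eq (p.continuous_eval.comp ?_) continuous_const).measurableSet
      exact Continuous.finCons (A := fun _ => ℝ) continuous_fst continuous_snd
    have hpre : {x : Fin (m + 1) → ℝ | eval x p = 0} =
        MeasurableEquiv.piFinSuccAbove (fun _ => ℝ) 0 ⁻¹' S := by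
      ext x
      have : (Fin.cons (x 0) (fun j : Fin m => x j.succ) : Fin (m + 1) → ℝ) = x :=
        Fin.cons_self_tail x
      simp [hS, Fin.insertNthEquiv, this, Fin.tail_def]
    rw [hpre, (volume_preserving_piFinSuccAbove (fun _ => ℝ) 0).measure_preimage
      hSm.nullMeasurableSet, Measure.volume_eq_prod, Measure.prod_apply_symm hSm]
    have hq : finSuccEquiv ℝ m p ≠ 0 := by simpa using hp
    obtain ⟨k, hk⟩ : ∃ k, (finSuccEquiv ℝ m p).coeff k ≠ 0 := by
      by_contra! h
      exact hq (Polynomial.ext (by simpa using h))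
    have hae : ∀ᵐ s : Fin m → ℝ, eval s ((finSuccEquiv ℝ m p).coeff k) ≠ 0 := by
      simpa [ae_iff] using ih hk
    rw [lintegral_eq_zero_iff' (measurable_measure_prodMk_right hSm).aemeasurable]
    filter_upwards [hae] with s hs
    have hne : Polynomial.map (eval s) (finSuccEquiv ℝ m p) ≠ 0 := fun h0 => hs (by
      simpa using congrArg (fun r => Polynomial.coeff r k) h0)
    refine Set.Finite.measure_zero (Set.Finite.subset (Polynomial.finite_setOfPred_isRoot hne) ?_) _
    intro y hy
    simpa [hS, eval_eq_eval_mv_eval', Polynomial.IsRoot] using hy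

/-- The zero set of a nonzero polynomial is a null set, with respect to any linear coordinates on
a finite-dimensional space. -/
theorem MvPolynomial.ae_eval_ne_zero {ι Z : Type*} [Finite ι]
    [NormedAddCommGroup Z] [NormedSpace ℝ Z] [MeasurableSpace Z] [BorelSpace Z]
    (μ : Measure Z) [μ.IsAddHaarMeasure] (Φ : Z ≃L[ℝ] (ι → ℝ)) {p : MvPolynomial ι ℝ}
    (hp : p ≠ 0) : ∀ᵐ z ∂μ, eval (Φ z) p ≠ 0 := by
  obtain ⟨m, ⟨e⟩⟩ := Finite.exists_equiv_fin ι
  let Ψ : Z ≃L[ℝ] (Fin m → ℝ) :=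
    Φ.trans (LinearEquiv.funCongrLeft ℝ ℝ e.symm).toContinuousLinearEquiv
  have hmap : (μ.map Ψ).IsAddHaarMeasure := Ψ.isAddHaarMeasure_map μ
  have hac : μ.map Ψ ≪ volume := Measure.absolutelyContinuous_isAddHaarMeasure _ _
  have h0 : μ.map Ψ {x | eval x (rename e p) = 0} = 0 :=
    hac (volume_eval_eq_zero_fin (by
      simpa using (rename_injective e e.injective).ne hp))
  have h1 : ∀ᵐ x ∂μ.map Ψ, eval x (rename e p) ≠ 0 := by simpa [ae_iff] using h0
  filter_upwards [ae_of_ae_map Ψ.continuous.aemeasurable h1] with z hz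
  rw [eval_rename] at hz
  convert hz using 3
  ext i
  simp [Ψ, LinearMap.funLeft]

/-- If `½ ∑ (q_k - y_k)²` has no formal derivative in the parameter variables, then every `q_k` is
independent of the parameters: with the other variables fixed, each square is bounded by the
constant value of the sum, and bounded polynomials are constant. -/
theorem MvPolynomial.eval_eq_of_pderiv_sum_sq_eq_zero {α β κ : Type*} [Fintype α] [Fintype β]
    [Fintype κ] (q : κ → MvPolynomial (α ⊕ β) ℝ) (y : κ → ℝ)
    (h : ∀ i, pderiv (Sum.inl i) (C (1 / 2) * ∑ k, (q k - C (y k)) ^ 2) = 0)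
    (k : κ) (a a' : α → ℝ) (b : β → ℝ) :
    eval (Sum.elim a b) (q k) = eval (Sum.elim a' b) (q k) := by
  set Q : MvPolynomial (α ⊕ β) ℝ := C (1 / 2) * ∑ k, (q k - C (y k)) ^ 2 with hQ
  set d : α ⊕ β → ℝ := Sum.elim (a - a') 0 with hd
  have hder (t : ℝ) : HasDerivAt (fun s : ℝ => eval (Sum.elim a' b + s • d) Q) 0 t := by
    have h1 : HasDerivAt (fun s : ℝ => Sum.elim a' b + s • d) d t := by
      simpa using ((hasDerivAt_id t).smul_const d).const_add (Sum.elim a' b)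
    refine ((Q.hasFDerivAt_eval (Sum.elim a' b + t • d)).comp_hasDerivAt t h1).congr_deriv ?_
    simp [hd, h]
  have hconst (t : ℝ) : eval (Sum.elim a' b + t • d) Q = eval (Sum.elim a' b) Q := by
    have := is_const_of_deriv_eq_zero (fun t => (hder t).differentiableAt)
      (fun t => (hder t).deriv) t 0
    simpa using this
  have hbound (t : ℝ) : |eval (Sum.elim a' b + t • d) (q k)| ≤
      (2 * eval (Sum.elim a' b) Q + 1) + |y k| := by
    have h2 : (eval (Sum.elim a' b + t • d) (q k) - y k) ^ 2 ≤ 2 * eval (Sum.elim a' b) Q := by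
      rw [← hconst t, hQ]
      simp only [map_mul, map_sum, map_pow, map_sub, eval_C]
      rw [← mul_assoc]
      norm_num
      exact Finset.single_le_sum
        (f := fun k => (eval (Sum.elim a' b + t • d) (q k) - y k) ^ 2)
        (fun _ _ => sq_nonneg _) (Finset.mem_univ k)
    -- The bound `|r| ≤ r² + 1` replaces a square root.
    have h3 : |eval (Sum.elim a' b + t • d) (q k) - y k| ≤ 2 * eval (Sum.elim a' b) Q + 1 := by
      rw [← sq_abs] at h2
      nlinarith [sq_nonneg (|eval (Sum.elim a' b + t • d) (q k) - y k| - 1)]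
    have h4 := abs_sub_abs_le_abs_sub (eval (Sum.elim a' b + t • d) (q k)) (y k)
    linarith
  have := (q k).eval_add_eq_of_bounded _ d hbound
  rw [← this]
  congr 2
  ext (i | j) <;> simp [hd]

/-! ### Almost everywhere locally polynomial functions -/

/-- To prove a property almost everywhere, it suffices to prove it almost everywhere on each of
the open sets where the data have a given local form, if almost every point lies in one. -/
theorem MeasureTheory.ae_of_ae_eventually {Z A : Type*} [TopologicalSpace Z]
    [SecondCountableTopology Z] [MeasurableSpace Z] {μ : Measure Z} {form : A → Z → Prop}
    {R : Z → Prop} (h : ∀ᵐ z ∂μ, ∃ a, ∀ᶠ w in nhds z, form a w)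
    (hR : ∀ a, ∀ᵐ w ∂μ, form a w → R w) : ∀ᵐ z ∂μ, R z := by
  have hnull : μ ({z | ¬R z} ∩ {z | ∃ a, ∀ᶠ w in nhds z, form a w}) = 0 := by
    refine measure_null_of_locally_null _ ?_
    rintro z ⟨-, a, ha⟩
    refine ⟨_, Filter.inter_mem self_mem_nhdsWithin (mem_nhdsWithin_of_mem_nhds ha), ?_⟩
    refine measure_mono_null ?_ (ae_iff.1 (hR a))
    rintro w ⟨⟨hw, -⟩, hf⟩ himp
    exact hw (himp hf)
  have hnull' : ∀ᵐ z ∂μ, ¬(¬R z ∧ ∃ a, ∀ᶠ w in nhds z, form a w) := by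
    rw [ae_iff]
    convert hnull using 2
    ext z
    simp
  filter_upwards [h, hnull'] with z h1 h2
  by_contra h3
  exact h2 ⟨h3, h1⟩

/-- A function on `Z` that near almost every point coincides with a polynomial in the
coordinates `Φ`; the polynomial may depend on the point. -/
def IsAELocallyPolynomial {Z ι : Type*} [TopologicalSpace Z] [MeasurableSpace Z] (μ : Measure Z)
    (Φ : Z → ι → ℝ) (F : Z → ℝ) : Prop :=
  ∀ᵐ z ∂μ, ∃ p : MvPolynomial ι ℝ, ∀ᶠ w in nhds z, F w = MvPolynomial.eval (Φ w) p

/-- Off a finite set, a piecewise polynomial function coincides locally with a polynomial: a closed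
interval has at most its two endpoints outside its interior. -/
theorem IsPiecewisePolynomial.exists_finite {σ : ℝ → ℝ} (hσ : IsPiecewisePolynomial σ) :
    ∃ B : Set ℝ, B.Finite ∧ ∀ x ∉ B, ∃ p : Polynomial ℝ, ∀ᶠ t in nhds x, σ t = p.eval t := by
  obtain ⟨m, S, p, hS, hcover, hp⟩ := hσ
  refine ⟨⋃ i, ({x | IsLeast (S i) x} ∪ {x | IsGreatest (S i) x}),
    Set.finite_iUnion fun i => Set.Finite.union
      (Set.Subsingleton.finite fun _ h _ h' => h.unique h')
      (Set.Subsingleton.finite fun _ h _ h' => h.unique h'), fun x hx => ?_⟩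
  obtain ⟨i, hi⟩ := Set.mem_iUnion.1 (hcover.symm ▸ Set.mem_univ x)
  have hx' : ¬IsLeast (S i) x ∧ ¬IsGreatest (S i) x := by
    constructor <;> exact fun h => hx (Set.mem_iUnion.2 ⟨i, by simp [h]⟩)
  have h1 : ∃ a ∈ S i, a < x := by
    by_contra! h
    exact hx'.1 ⟨hi, h⟩
  have h2 : ∃ b ∈ S i, x < b := by
    by_contra! h
    exact hx'.2 ⟨hi, h⟩
  obtain ⟨a, ha, hax⟩ := h1
  obtain ⟨b, hb, hxb⟩ := h2
  refine ⟨p i, ?_⟩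
  filter_upwards [Icc_mem_nhds hax hxb] with t ht
  exact hp i t ((hS i).2.out ha hb ht)

namespace IsAELocallyPolynomial

section Composition

variable {Z ι κ : Type*} [TopologicalSpace Z] [MeasurableSpace Z] {μ : Measure Z} {Φ : Z → ι → ℝ}

theorem mvPolynomial_eval [Finite κ] {F : κ → Z → ℝ} (hF : ∀ k, IsAELocallyPolynomial μ Φ (F k))
    (g : MvPolynomial κ ℝ) :
    IsAELocallyPolynomial μ Φ (fun z => MvPolynomial.eval (fun k => F k z) g) := by
  filter_upwards [ae_all_iff.2 hF] with z hz
  choose p hp using hz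
  refine ⟨MvPolynomial.bind₁ p g, ?_⟩
  filter_upwards [Filter.eventually_all.2 hp] with w hw
  simp only [hw]
  exact (MvPolynomial.eval₂Hom_bind₁ (RingHom.id ℝ) (Φ w) p g).symm

end Composition

variable {Z ι : Type*} [Finite ι] [NormedAddCommGroup Z] [NormedSpace ℝ Z]
  [FiniteDimensional ℝ Z] [MeasurableSpace Z] [BorelSpace Z] {μ : Measure Z}
  [μ.IsAddHaarMeasure] {Φ : Z ≃L[ℝ] (ι → ℝ)}

/-- Where `F` is locally a polynomial `p`, either `p` is constant, and `σ ∘ F` is locally constant,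
or `p` avoids the breakpoints of `σ` almost everywhere. -/
theorem comp_isPiecewisePolynomial {σ : ℝ → ℝ} (hσ : IsPiecewisePolynomial σ) {F : Z → ℝ}
    (hF : IsAELocallyPolynomial μ Φ F) : IsAELocallyPolynomial μ Φ (fun z => σ (F z)) := by
  obtain ⟨B, hB, hloc⟩ := hσ.exists_finite
  have : ProperSpace Z := FiniteDimensional.proper_real Z
  refine ae_of_ae_eventually (A := MvPolynomial ι ℝ)
    (form := fun p z => ∀ᶠ w in nhds z, F w = MvPolynomial.eval (Φ w) p) ?_ fun p => ?_
  · filter_upwards [hF] with z ⟨p, hp⟩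
    exact ⟨p, eventually_eventually_nhds.2 hp⟩
  · by_cases hconst : ∃ b, p = MvPolynomial.C b
    · obtain ⟨b, rfl⟩ := hconst
      refine ae_of_all _ fun z hz => ⟨MvPolynomial.C (σ b), ?_⟩
      filter_upwards [hz] with w hw
      simp [hw]
    · have hne : ∀ᵐ z ∂μ, ∀ b ∈ B, MvPolynomial.eval (Φ z) (p - MvPolynomial.C b) ≠ 0 :=
        (ae_ball_iff hB.countable).2 fun b _ =>
          MvPolynomial.ae_eval_ne_zero μ Φ fun h0 => hconst ⟨b, sub_eq_zero.1 h0⟩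
      filter_upwards [hne] with z hz hFz
      obtain ⟨u, hu⟩ := hloc (MvPolynomial.eval (Φ z) p) fun hmem => hz _ hmem (by simp)
      refine ⟨Polynomial.aeval p u, ?_⟩
      have hcont : Filter.Tendsto (fun w => MvPolynomial.eval (Φ w) p) (nhds z)
          (nhds (MvPolynomial.eval (Φ z) p)) :=
        (p.continuous_eval.comp Φ.continuous).tendsto z
      filter_upwards [hFz, hcont.eventually hu] with w hw hw'
      rw [hw, hw', ← MvPolynomial.coe_aeval_eq_eval, RingHom.coe_coe,
        ← Polynomial.aeval_algHom_apply, Polynomial.coe_aeval_eq_eval]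

/-- Every network output is almost everywhere locally polynomial, if the inputs and parameters are.
The inputs are arbitrary functions of `Z` so that the induction can go through the hidden layers. -/
theorem polyLayers_eval {σ : ℝ → ℝ} (hσ : IsPiecewisePolynomial σ) {P N M : ℕ}
    (net : PolyLayers P N M) {θ : Z → Fin P → ℝ} (hθ : ∀ i, IsAELocallyPolynomial μ Φ (θ · i))
    {x : Z → Fin N → ℝ} (hx : ∀ i, IsAELocallyPolynomial μ Φ (x · i)) (k : Fin M) :
    IsAELocallyPolynomial μ Φ (fun z => net.eval σ (θ z) (x z) k) := by
  have hlayer {N : ℕ} {x : Z → Fin N → ℝ} (hx : ∀ i, IsAELocallyPolynomial μ Φ (x · i))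
      (g : MvPolynomial (Fin N ⊕ Fin P) ℝ) :
      IsAELocallyPolynomial μ Φ (fun z => MvPolynomial.eval (Sum.elim (x z) (θ z)) g) := by
    have := mvPolynomial_eval (F := fun s z => Sum.elim (x z) (θ z) s)
      (by rintro (i | i); exacts [hx i, hθ i]) g
    exact this
  induction net with
  | last g => exact hlayer hx (g k)
  | cons g rest ih => exact ih (fun i => (hlayer hx (g i)).comp_isPiecewisePolynomial hσ) k

end IsAELocallyPolynomial

/-! ### Gradient flow from a point with nonzero gradient -/

/-- A continuous function whose derivative is nonpositive off a finite set does not increase. -/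
theorem le_of_hasDerivAt_nonpos_of_finite {S : Set ℝ} (hS : S.Finite) {f : ℝ → ℝ} {a b : ℝ}
    (hab : a ≤ b) (hf : ContinuousOn f (Set.Icc a b))
    (hd : ∀ t ∈ Set.Ioo a b \ S, ∃ d ≤ 0, HasDerivAt f d t) : f b ≤ f a := by
  induction S, hS using Set.Finite.induction_on generalizing a b with
  | empty =>
    refine antitoneOn_of_deriv_nonpos (convex_Icc a b) hf ?_ ?_ (Set.left_mem_Icc.2 hab)
      (Set.right_mem_Icc.2 hab) hab
    · intro t ht
      rw [interior_Icc] at ht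
      obtain ⟨d, -, h⟩ := hd t (by simpa using ht)
      exact h.differentiableAt.differentiableWithinAt
    · intro t ht
      rw [interior_Icc] at ht
      obtain ⟨d, hd0, h⟩ := hd t (by simpa using ht)
      rwa [h.deriv]
  | @insert s S _ _ ih =>
    by_cases hs : s ∈ Set.Ioo a b
    · refine (ih hs.2.le (hf.mono (Set.Icc_subset_Icc_left hs.1.le)) ?_).trans
        (ih hs.1.le (hf.mono (Set.Icc_subset_Icc_right hs.2.le)) ?_)
      · rintro t ⟨ht, htS⟩
        refine hd t ⟨⟨hs.1.trans ht.1, ht.2⟩, ?_⟩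
        rintro (rfl | h)
        exacts [lt_irrefl _ ht.1, htS h]
      · rintro t ⟨ht, htS⟩
        refine hd t ⟨⟨ht.1, ht.2.trans hs.2⟩, ?_⟩
        rintro (rfl | h)
        exacts [lt_irrefl _ ht.2, htS h]
    · refine ih hab hf fun t ht => hd t ⟨ht.1, ?_⟩
      rintro (rfl | h)
      exacts [hs ht.1, ht.2 h]

namespace IsGradientFlow

variable {P : ℕ} {Loss : EuclideanSpace ℝ (Fin P) → ℝ} {θ₀ : EuclideanSpace ℝ (Fin P)} {T : ℝ}
  {θ : ℝ → EuclideanSpace ℝ (Fin P)}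

/-- A comparison principle along a gradient flow curve: if a function `G` has derivative
`d s v ≤ 0` at time `s` whenever `v` is the gradient at `θ s`, then `G` does not increase. -/
theorem le_of_deriv_nonpos (h : IsGradientFlow Loss θ₀ T θ) {G : ℝ → ℝ} {a b : ℝ} (ha : 0 ≤ a)
    (hab : a ≤ b) (hb : b ≤ T) (hG : ContinuousOn G (Set.Icc a b))
    (d : ℝ → EuclideanSpace ℝ (Fin P) → ℝ)
    (hd : ∀ s ∈ Set.Ioo a b, ∀ v, HasGradientAt Loss v (θ s) → HasDerivAt θ (-v) s →
      HasDerivAt (fun r => Loss (θ r)) (-‖v‖ ^ 2) s → d s v ≤ 0 ∧ HasDerivAt G (d s v) s) :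
    G b ≤ G a := by
  obtain ⟨S, hS, hflow⟩ := h.flow
  refine le_of_hasDerivAt_nonpos_of_finite hS hab hG fun t ht => ?_
  obtain ⟨v, hv, hθ⟩ := hflow t ⟨⟨ha.trans_lt ht.1.1, ht.1.2.trans_le hb⟩, ht.2⟩
  have hL : HasDerivAt (fun r => Loss (θ r)) (-‖v‖ ^ 2) t := by
    refine (hv.hasFDerivAt.comp_hasDerivAt t hθ).congr_deriv ?_
    simp
  exact ⟨d t v, hd t ht.1 v hv hθ hL⟩

theorem loss_antitone (h : IsGradientFlow Loss θ₀ T θ) (hL : Continuous Loss) {a b : ℝ}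
    (ha : 0 ≤ a) (hab : a ≤ b) (hb : b ≤ T) : Loss (θ b) ≤ Loss (θ a) :=
  h.le_of_deriv_nonpos ha hab hb
    (hL.comp_continuousOn (h.continuousOn.mono (Set.Icc_subset_Icc ha hb))) (fun _ v => -‖v‖ ^ 2)
    fun _ _ v _ _ hd => ⟨by simp, hd⟩

/-- The energy estimate for the distance travelled. -/
theorem norm_sub_le (h : IsGradientFlow Loss θ₀ T θ) (hL : Continuous Loss)
    (hL0 : ∀ x, 0 ≤ Loss x) {a : ℝ} (ha : 0 < a) {t : ℝ} (ht : t ∈ Set.Icc 0 T) :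
    ‖θ t - θ₀‖ ≤ a * t + Loss θ₀ / (4 * a) := by
  set w := θ t - θ₀ with hw
  have hcont : ContinuousOn θ (Set.Icc 0 t) := h.continuousOn.mono (Set.Icc_subset_Icc_right ht.2)
  -- The curve moves in direction `w` at speed at most `‖w‖ ‖v‖ ≤ ‖w‖ (a + ‖v‖² / (4a))`.
  have key := h.le_of_deriv_nonpos (a := 0) (b := t)
    (G := fun s => inner ℝ w (θ s) - ‖w‖ * (a * s - Loss (θ s) / (4 * a))) le_rfl ht.1 ht.2
    ((continuousOn_const.inner hcont).sub (continuousOn_const.mul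
      ((continuousOn_const.mul continuousOn_id).sub
        ((hL.comp_continuousOn hcont).div_const _))))
    (fun s v => inner ℝ w (-v) - ‖w‖ * (a - -‖v‖ ^ 2 / (4 * a))) (by
      intro s _ v _ hθ hd
      constructor
      · have h1 : inner ℝ w (-v) ≤ ‖w‖ * ‖v‖ := by
          simpa using real_inner_le_norm w (-v)
        have h2 : ‖v‖ ≤ a - -‖v‖ ^ 2 / (4 * a) := by
          have : a - -‖v‖ ^ 2 / (4 * a) - ‖v‖ = (‖v‖ - 2 * a) ^ 2 / (4 * a) := by
            field_simp; ring
          have : 0 ≤ (‖v‖ - 2 * a) ^ 2 / (4 * a) := by positivity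
          linarith
        nlinarith [mul_le_mul_of_nonneg_left h2 (norm_nonneg w)]
      · have h1 : HasDerivAt (fun r => inner ℝ w (θ r)) (inner ℝ w (-v)) s := by
          simpa using (hasDerivAt_const s w).inner ℝ hθ
        have h2 : HasDerivAt (fun r : ℝ => a * r) a s := by
          simpa using (hasDerivAt_id s).const_mul a
        exact h1.sub ((h2.sub (hd.div_const _)).const_mul _))
  simp only [h.init, mul_zero, zero_sub] at key
  have h3 : ‖w‖ * ‖w‖ = inner ℝ w (θ t) - inner ℝ w θ₀ := by
    rw [← inner_sub_right, ← hw, real_inner_self_eq_norm_mul_norm]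
  have h4 : 0 ≤ ‖w‖ * (Loss (θ t) / (4 * a)) := by have := hL0 (θ t); positivity
  have h5 : ‖w‖ * ‖w‖ ≤ ‖w‖ * (a * t + Loss θ₀ / (4 * a)) := by linarith
  rcases (norm_nonneg w).eq_or_lt with h0 | h0
  · rw [← h0]
    have := hL0 θ₀
    have := ht.1
    positivity
  · exact le_of_mul_le_mul_left h5 h0

end IsGradientFlow

/-- If a nonnegative continuous loss is continuously differentiable near `θ₀` with nonzero gradient
there, then it decays exponentially on `[0, T]` along all gradient flow curves from `θ₀`, at a
common rate. By the energy estimate the curves stay for a common time in a ball in which the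
gradient is bounded below; the loss lost during that time is never regained. -/
theorem exists_exp_decay_of_fderiv_ne_zero {P : ℕ} {Loss : EuclideanSpace ℝ (Fin P) → ℝ}
    {θ₀ : EuclideanSpace ℝ (Fin P)} (hL : Continuous Loss) (hL0 : ∀ x, 0 ≤ Loss x)
    (hC : ContDiffAt ℝ 1 Loss θ₀) (hne : fderiv ℝ Loss θ₀ ≠ 0) {T : ℝ} (hT : 0 < T) :
    ∃ lam : ℝ, 0 < lam ∧ ∀ θ : ℝ → EuclideanSpace ℝ (Fin P), IsGradientFlow Loss θ₀ T θ →
      ∀ t ∈ Set.Icc 0 T, Loss (θ t) ≤ Real.exp (-2 * lam * t) * Loss (θ 0) := by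
  set m := ‖fderiv ℝ Loss θ₀‖ / 2 with hm
  have hm0 : 0 < m := by have := norm_pos_iff.2 hne; positivity
  have hcont : ContinuousAt (fderiv ℝ Loss) θ₀ := hC.continuousAt_fderiv one_ne_zero
  have hev : ∀ᶠ x in nhds θ₀, m < ‖fderiv ℝ Loss x‖ :=
    hcont.norm.eventually_const_lt (by linarith)
  obtain ⟨r, hr, hball⟩ := Metric.eventually_nhds_iff.1 hev
  have hl0 := hL0 θ₀
  -- With this `a`, the energy estimate gives a displacement below `a * t + r / 2`.
  set a := Loss θ₀ / (2 * r) + 1 with ha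
  have ha0 : 0 < a := by positivity
  have har : Loss θ₀ / (4 * a) < r / 2 := by
    rw [div_lt_iff₀ (by positivity), ha]
    field_simp
    nlinarith
  set ε := min T (r / (4 * a)) with hε
  have hε0 : 0 < ε := lt_min hT (by positivity)
  have hεT : ε ≤ T := min_le_left _ _
  -- The drop `m² ε` is reached by time `ε`; the rate `c` spreads it over all of `[0, T]`.
  set c := m ^ 2 * ε / T with hc
  have hc0 : 0 < c := by positivity
  refine ⟨c / (2 * (Loss θ₀ + 1)), by positivity, fun θ h t ht => ?_⟩
  have hin : ∀ s ∈ Set.Icc 0 ε, dist (θ s) θ₀ < r := by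
    intro s hs
    rw [dist_eq_norm]
    have h1 := h.norm_sub_le hL hL0 ha0 ⟨hs.1, hs.2.trans hεT⟩
    have h2 : a * s ≤ r / 4 := by
      have : s ≤ r / (4 * a) := hs.2.trans (min_le_right _ _)
      rw [le_div_iff₀ (by positivity)] at this
      linarith
    linarith
  have hshort : ∀ s ∈ Set.Icc 0 ε, Loss (θ s) ≤ Loss θ₀ - m ^ 2 * s := by
    intro s hs
    have key := h.le_of_deriv_nonpos (a := 0) (b := s) (G := fun r => Loss (θ r) + m ^ 2 * r)
      le_rfl hs.1 (hs.2.trans hεT)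
      ((hL.comp_continuousOn (h.continuousOn.mono
        (Set.Icc_subset_Icc_right (hs.2.trans hεT)))).add (by fun_prop))
      (fun _ v => -‖v‖ ^ 2 + m ^ 2) (by
        intro u hu v hv _ hd
        constructor
        · have h1 := hball (hin u ⟨hu.1.le, hu.2.le.trans hs.2⟩)
          rw [hv.hasFDerivAt.fderiv, LinearIsometryEquiv.norm_map] at h1
          nlinarith
        · simpa using hd.fun_add ((hasDerivAt_id u).const_mul (m ^ 2)))
    simp only [h.init, mul_zero, add_zero] at key
    linarith
  have hlin : Loss (θ t) ≤ Loss θ₀ - c * t := by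
    have hcm : c ≤ m ^ 2 := by
      rw [hc, div_le_iff₀ hT]
      gcongr
    rcases le_total t ε with hte | hte
    · have := hshort t ⟨ht.1, hte⟩
      nlinarith [mul_le_mul_of_nonneg_right hcm ht.1]
    · have h1 := h.loss_antitone hL hε0.le hte ht.2
      have h2 := hshort ε ⟨hε0.le, le_rfl⟩
      have h3 : c * t ≤ c * T := by gcongr; exact ht.2
      have h4 : c * T = m ^ 2 * ε := by rw [hc]; field_simp
      linarith
  rw [h.init]
  refine hlin.trans ?_
  have h1 := Real.add_one_le_exp (-2 * (c / (2 * (Loss θ₀ + 1))) * t)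
  refine le_trans ?_ (mul_le_mul_of_nonneg_right h1 hl0)
  have h2 : -2 * (c / (2 * (Loss θ₀ + 1))) * t = -(c * t / (Loss θ₀ + 1)) := by
    field_simp
  have h3 : c * t / (Loss θ₀ + 1) * Loss θ₀ ≤ c * t := by
    have := ht.1
    rw [div_mul_eq_mul_div, div_le_iff₀ (by positivity)]
    nlinarith [mul_nonneg hc0.le this]
  rw [h2]
  linarith

/-! ### The loss at a random initialization and random inputs -/

namespace PolyLayers

variable {P N M n : ℕ}

theorem continuous_eval {σ : ℝ → ℝ} (hσ : Continuous σ) (net : PolyLayers P N M)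
    {Z : Type*} [TopologicalSpace Z] {θ : Z → Fin P → ℝ} (hθ : Continuous θ)
    {x : Z → Fin N → ℝ} (hx : Continuous x) : Continuous fun z => net.eval σ (θ z) (x z) := by
  have hlayer {N : ℕ} {x : Z → Fin N → ℝ} (hx : Continuous x)
      (g : MvPolynomial (Fin N ⊕ Fin P) ℝ) :
      Continuous (fun z => MvPolynomial.eval (Sum.elim (x z) (θ z)) g) := by
    refine g.continuous_eval.comp (continuous_pi ?_)
    rintro (i | i)
    exacts [(continuous_apply i).comp hx, (continuous_apply i).comp hθ]
  induction net with
  | last g => exact continuous_pi fun k => hlayer hx (g k)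
  | cons g rest ih => exact ih (continuous_pi fun k => hσ.comp (hlayer hx (g k)))

theorem loss_eq_sum (net : PolyLayers P N M) (σ : ℝ → ℝ)
    (X : Fin n → EuclideanSpace ℝ (Fin N)) (y : Fin n → EuclideanSpace ℝ (Fin M))
    (θ : EuclideanSpace ℝ (Fin P)) :
    net.loss σ X y θ =
      (1 / 2 : ℝ) * ∑ q : Fin n × Fin M, (net.eval σ θ (X q.1) q.2 - y q.1 q.2) ^ 2 := by
  simp [loss, f, EuclideanSpace.norm_sq_eq, Fintype.sum_prod_type]

theorem loss_eq_half_norm_sq (net : PolyLayers P N M) (σ : ℝ → ℝ)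
    (X : Fin n → EuclideanSpace ℝ (Fin N)) (y : Fin n → EuclideanSpace ℝ (Fin M))
    (θ : EuclideanSpace ℝ (Fin P)) :
    net.loss σ X y θ = (1 / 2 : ℝ) * ‖stack y - stack (fun j => net.f σ (X j) θ)‖ ^ 2 := by
  simp [loss_eq_sum, stack, f, EuclideanSpace.norm_sq_eq, sub_sq_comm (y _ _)]

instance isAddHaarMeasure_volume : (volume : Measure
    (EuclideanSpace ℝ (Fin P) × (Fin n → EuclideanSpace ℝ (Fin N)))).IsAddHaarMeasure := by
  have : (volume : Measure (Fin n → EuclideanSpace ℝ (Fin N))).IsAddHaarMeasure :=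
    Measure.pi.isAddHaarMeasure _
  exact Measure.prod.instIsAddHaarMeasure volume volume

/-- The coordinates of the initialization and of all inputs. -/
noncomputable def coordinates (P N n : ℕ) :
    (EuclideanSpace ℝ (Fin P) × (Fin n → EuclideanSpace ℝ (Fin N))) ≃L[ℝ]
      (Fin P ⊕ Fin n × Fin N → ℝ) :=
  LinearEquiv.toContinuousLinearEquiv
    { toFun := fun ω => Sum.elim ω.1 (fun q => ω.2 q.1 q.2)
      invFun := fun c => (WithLp.toLp 2 (fun i => c (Sum.inl i)),
        fun j => WithLp.toLp 2 (fun i => c (Sum.inr (j, i))))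
      map_add' := by intro a b; ext (i | q) <;> simp
      map_smul' := by intro a b; ext (i | q) <;> simp
      left_inv := by intro a; rfl
      right_inv := by intro c; ext (i | q) <;> rfl }

theorem coordinates_apply (ω : EuclideanSpace ℝ (Fin P) × (Fin n → EuclideanSpace ℝ (Fin N))) :
    coordinates P N n ω = Sum.elim ω.1 (fun q => ω.2 q.1 q.2) := rfl

/-- Near almost every initialization and inputs, the loss is a polynomial whose partial
derivative in some parameter does not vanish. -/
theorem ae_loss_eq_polynomial {σ : ℝ → ℝ} (hσ : IsPiecewisePolynomial σ) (net : PolyLayers P N M)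
    (hnet : net.DependsOnParameters σ) (y : Fin n → EuclideanSpace ℝ (Fin M)) (j₀ : Fin n) :
    ∀ᵐ ω : EuclideanSpace ℝ (Fin P) × (Fin n → EuclideanSpace ℝ (Fin N)),
      ∃ Q : MvPolynomial (Fin P ⊕ Fin n × Fin N) ℝ,
        (∀ᶠ z in nhds ω, net.loss σ z.2 y z.1 = MvPolynomial.eval (coordinates P N n z) Q) ∧
        ∃ i, MvPolynomial.eval (coordinates P N n ω) (MvPolynomial.pderiv (Sum.inl i) Q) ≠ 0 := by
  have hproj (s : Fin P ⊕ Fin n × Fin N) :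
      IsAELocallyPolynomial volume (coordinates P N n) (fun ω => coordinates P N n ω s) :=
    ae_of_all _ fun ω => ⟨MvPolynomial.X s, by simp⟩
  have hpoly : ∀ᵐ ω : EuclideanSpace ℝ (Fin P) × (Fin n → EuclideanSpace ℝ (Fin N)),
      ∀ q : Fin n × Fin M, ∃ p : MvPolynomial (Fin P ⊕ Fin n × Fin N) ℝ, ∀ᶠ z in nhds ω,
        net.eval σ z.1 (z.2 q.1) q.2 = MvPolynomial.eval (coordinates P N n z) p :=
    ae_all_iff.2 fun q => IsAELocallyPolynomial.polyLayers_eval hσ net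
      (fun i => hproj (Sum.inl i)) (fun i => hproj (Sum.inr (q.1, i))) q.2
  refine ae_of_ae_eventually (A := Fin n × Fin M → MvPolynomial (Fin P ⊕ Fin n × Fin N) ℝ)
    (form := fun p ω => ∀ᶠ z in nhds ω, ∀ q,
      net.eval σ z.1 (z.2 q.1) q.2 = MvPolynomial.eval (coordinates P N n z) (p q)) ?_ fun p => ?_
  · filter_upwards [hpoly] with ω hω
    choose p hp using hω
    exact ⟨p, eventually_eventually_nhds.2 (Filter.eventually_all.2 hp)⟩
  · set Q : MvPolynomial (Fin P ⊕ Fin n × Fin N) ℝ :=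
      MvPolynomial.C (1 / 2) * ∑ q, (p q - MvPolynomial.C (y q.1 q.2)) ^ 2 with hQ
    by_cases hder : ∀ i, MvPolynomial.pderiv (Sum.inl i) Q = 0
    -- The outputs would be independent of the parameters near `ω`.
    · refine ae_of_all _ fun ω hω => ?_
      exfalso
      rw [nhds_prod_eq, Filter.eventually_prod_iff] at hω
      obtain ⟨pV, hV, pW, hW, hVW⟩ := hω
      have hU : ∀ᶠ x in nhds (ω.2 j₀), pW (Function.update ω.2 j₀ x) := by
        have hc : Filter.Tendsto (fun x => Function.update ω.2 j₀ x) (nhds (ω.2 j₀))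
            (nhds ω.2) := by
          have := (continuous_const (y := ω.2)).update j₀ continuous_id
          simpa using this.tendsto (ω.2 j₀)
        exact hc.eventually hW
      obtain ⟨U, hUs, hUo, hUm⟩ := eventually_nhds_iff.1 hU
      obtain ⟨V, hVs, hVo, hVm⟩ := eventually_nhds_iff.1 hV
      obtain ⟨x, hx, θ, hθ, θ', hθ', hne⟩ := hnet U V hUo ⟨_, hUm⟩ hVo ⟨_, hVm⟩
      refine hne ?_
      ext k
      have h1 := hVW (hVs θ hθ) (hUs x hx) (j₀, k)
      have h2 := hVW (hVs θ' hθ') (hUs x hx) (j₀, k)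
      simp only [Function.update_self, coordinates_apply] at h1 h2
      change net.eval σ θ x k = net.eval σ θ' x k
      rw [h1, h2]
      exact MvPolynomial.eval_eq_of_pderiv_sum_sq_eq_zero p (fun q => y q.1 q.2) hder (j₀, k) _ _ _
    · push Not at hder
      obtain ⟨i, hi⟩ := hder
      filter_upwards [MvPolynomial.ae_eval_ne_zero volume (coordinates P N n) hi] with ω hω hloc
      refine ⟨Q, ?_, i, hω⟩
      filter_upwards [hloc] with z hz
      simp [loss_eq_sum, hQ, hz]

/-- At almost every initialization and inputs, the loss is smooth with nonzero gradient. -/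
theorem ae_contDiffAt_loss_and_fderiv_ne_zero {σ : ℝ → ℝ} (hσ : IsPiecewisePolynomial σ)
    (net : PolyLayers P N M) (hnet : net.DependsOnParameters σ)
    (y : Fin n → EuclideanSpace ℝ (Fin M)) (j₀ : Fin n) :
    ∀ᵐ ω : EuclideanSpace ℝ (Fin P) × (Fin n → EuclideanSpace ℝ (Fin N)),
      ContDiffAt ℝ 1 (net.loss σ ω.2 y) ω.1 ∧ fderiv ℝ (net.loss σ ω.2 y) ω.1 ≠ 0 := by
  filter_upwards [ae_loss_eq_polynomial hσ net hnet y j₀] with ω ⟨Q, hQ, i, hi⟩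
  have hloc : net.loss σ ω.2 y =ᶠ[nhds ω.1]
      fun θ => MvPolynomial.eval (coordinates P N n (θ, ω.2)) Q :=
    (Continuous.prodMk_left ω.2).tendsto ω.1 |>.eventually hQ
  constructor
  · refine ContDiffAt.congr_of_eventuallyEq ?_ hloc
    have h1 : ContDiff ℝ 1 fun c : Fin P ⊕ Fin n × Fin N → ℝ => MvPolynomial.eval c Q :=
      (AnalyticOnNhd.eval_mvPolynomial Q).contDiff
    exact (h1.comp ((coordinates P N n).contDiff.comp
      (contDiff_id.prodMk contDiff_const))).contDiffAt
  · rw [hloc.fderiv_eq]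
    have h1 := (Q.hasFDerivAt_eval (coordinates P N n ω)).comp ω.1
      ((coordinates P N n).hasFDerivAt.comp ω.1 (hasFDerivAt_prodMk_left ω.1 ω.2))
    have h2 : HasFDerivAt (fun θ => MvPolynomial.eval (coordinates P N n (θ, ω.2)) Q) _ ω.1 := h1
    rw [h2.fderiv]
    intro h0
    refine hi ?_
    have := DFunLike.congr_fun h0 (EuclideanSpace.single i 1)
    simpa [coordinates_apply, Pi.single_apply] using this

end PolyLayers

theorem mainTheorem1 {N P M n : ℕ} (hP : n * M ≤ P)
    (σ : ℝ → ℝ) (hσ_cont : Continuous σ) (hσ_poly : IsPiecewisePolynomial σ)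
    (hσ_zero : {x : ℝ | σ x = 0}.Finite)
    (net : PolyLayers P N M) (hnet : net.DependsOnParameters σ)
    (y : Fin n → EuclideanSpace ℝ (Fin M))
    (μ : Measure (EuclideanSpace ℝ (Fin P) × (Fin n → EuclideanSpace ℝ (Fin N))))
    [IsProbabilityMeasure μ] (hμ : μ ≪ volume) :
    ∀ᵐ ω ∂μ, ∀ T : ℝ, 0 < T → ∃ lam : ℝ, 0 < lam ∧
      ∀ θ : ℝ → EuclideanSpace ℝ (Fin P), IsGradientFlow (net.loss σ ω.2 y) ω.1 T θ →
        ∀ t ∈ Set.Icc 0 T,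
          ‖stack y - stack (fun j => net.f σ (ω.2 j) (θ t))‖
              ≤ Real.exp (-lam * t) * ‖stack y - stack (fun j => net.f σ (ω.2 j) (θ 0))‖ ∧
          net.loss σ ω.2 y (θ t) ≤ Real.exp (-2 * lam * t) * net.loss σ ω.2 y (θ 0) := by
  rcases Nat.eq_zero_or_pos n with rfl | hn
  -- Without samples, both sides of both inequalities vanish.
  · refine ae_of_all _ fun ω T _ => ⟨1, one_pos, fun θ _ t _ => ?_⟩
    simp [PolyLayers.loss, EuclideanSpace.norm_eq]
  refine hμ.ae_le ?_
  filter_upwards [PolyLayers.ae_contDiffAt_loss_and_fderiv_ne_zero hσ_poly net hnet y ⟨0, hn⟩]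
    with ω ⟨hC, hne⟩ T hT
  have hL : Continuous (net.loss σ ω.2 y) := by
    refine continuous_const.mul (continuous_finsetSum _ fun j _ => ?_)
    exact (((PiLp.continuous_toLp 2 _).comp (net.continuous_eval hσ_cont
      (PiLp.continuous_ofLp 2 _) continuous_const)).sub continuous_const).norm.pow 2
  have hL0 : ∀ θ, 0 ≤ net.loss σ ω.2 y θ := fun θ => by
    rw [PolyLayers.loss_eq_half_norm_sq]
    positivity
  obtain ⟨lam, hlam, h⟩ := exists_exp_decay_of_fderiv_ne_zero hL hL0 hC hne hT
  refine ⟨lam, hlam, fun θ hθ t ht => ⟨?_, h θ hθ t ht⟩⟩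
  have h1 := h θ hθ t ht
  rw [PolyLayers.loss_eq_half_norm_sq, PolyLayers.loss_eq_half_norm_sq,
    show -2 * lam * t = -lam * t + -lam * t by ring, Real.exp_add] at h1
  refine le_of_sq_le_sq ?_ (by positivity)
  linarith
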